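/- **Definitions.** A *triangulation* $T$ (of a square) is a finite oriented simplicial complex homeomorphic to a closed disk, with exactly four vertices on its boundary, labelled $\mathbf p,\mathbf q,\mathbf r,\mathbf s$ in the cyclic order given by the orientation. A *drawing* of $T$ is a map $\rho$ from the vertices of $T$ to $\mathbf C^2$ with $\rho(\mathbf p)+\rho(\mathbf r)=\rho(\mathbf q)+\rho(\mathbf s)$. Each triangle $\Delta$ of $T$, with vertices $v_1,v_2,v_3$ in an order compatible with the orientation and $\rho(v_i)=(x_i,y_i)$, has the area $$\tfrac12\det\begin{pmatrix}1&1&1\\x_1&x_2&x_3\\y_1&y_2&y_3\end{pmatrix}.$$ An *area polynomial* $p_T$ of $T$ is a homogeneous integer polynomial, in one variable $A_\Delta$ for each triangle $\Delta$ of $T$, whose coefficients have no common factor and which generates the ideal of all complex polynomials that vanish on the area tuples of all drawings of $T$; it is unique up to sign. For a set $L$ of $l$ variables, the *$l$-variable specialization* $p_T|_L$ is obtained from $p_T$ by substituting $0$ for all variables not in $L$. Let $K$ be a field of characteristic $0$ (for example $K=\mathbf Q$). Two polynomials in $l$ variables over $K$ are *equivalent* if they agree up to a nonzero scalar in $K$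 and a permutation of the variables. For $l\ge 1$ let $\mathcal E_l$ be the set of equivalence classes of irreducible factors over $K$ of $l$-variable specializations of area polynomials $p_T$, where $T$ ranges over all triangulations, and let $\mathcal E=\bigcup_{l\ge1}\mathcal E_l$ (the *area encyclopedia*). A polynomial is said to be in $\mathcal E$ if its equivalence class is. An *algebraic subdivision* of a polynomial $q$ in $n$ variables is a polynomial in $n+1$ variables obtained from $q$ by substituting $X'+X''$ for one of the $n$ variables $X$, where $X',X''$ are new variables. The *abridged encyclopedia* is $\tilde{\mathcal E}=\bigcup_{l\ge 1}\tilde{\mathcal E}_l$, where $\tilde{\mathcal E}_l$ consists of the polynomials in $\mathcal E_l$ that are not, up to equivalence, an algebraic subdivision of any polynomial in $\mathcal E_{l-1}$ (with $\mathcal E_0=\emptyset$). **Proposition.** 1. If $q^\star$ is an algebraic subdivision of $q$, then $q^\star\in\mathcal E$ if and only if $q\in\mathcal E$. 2. $\mathcal E$ is the closure of $\tilde{\mathcal E}$ under algebraic subdivision: a polynomial $q$ is in $\mathcal E$ if and only if $q$ can be obtained from some polynomial in $\tilde{\mathcal E}$ by a finite (possibly empty) sequence of algebraic subdivisions. -/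

import Mathlib

noncomputable section

namespace AreaEncyclopedia

open MvPolynomial

/-! ### Triangulations of a square -/

/-- A finite, pure two-dimensional simplicial complex with vertex set `V`, whose triangles are
indexed by `ι`.  The triple `tri i` lists the three vertices of the `i`-th triangle in an order
that represents the orientation of that triangle. -/
structure OrientedTriangles where
  V : Type
  ι : Type
  [fintypeV : Fintype V]
  [fintypeι : Fintype ι]
  tri : ι → Fin 3 → V
  tri_injective : ∀ i, Function.Injective (tri i)
  /-- a set of three vertices spans at most one triangle -/
  eq_of_range_eq : ∀ i j, Set.range (tri i) = Set.range (tri j) → i = j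
  /-- every vertex is a vertex of some triangle -/
  exists_mem_range : ∀ v, ∃ i, v ∈ Set.range (tri i)

attribute [instance] OrientedTriangles.fintypeV OrientedTriangles.fintypeι

/-- The underlying abstract simplicial complex: its faces are the nonempty subsets of the vertex
sets of the triangles. -/
def OrientedTriangles.complex (T : OrientedTriangles) : AbstractSimplicialComplex T.V where
  faces := {s | s.Nonempty ∧ ∃ i, (s : Set T.V) ⊆ Set.range (T.tri i)}
  isRelLowerSet_faces := by
    rintro s ⟨hs, i, hi⟩
    exact ⟨hs, fun t hts ht => ⟨ht, i, fun v hv => hi (hts hv)⟩⟩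
  singleton_mem := fun v => by
    obtain ⟨i, hi⟩ := T.exists_mem_range v
    exact ⟨Finset.singleton_nonempty v, i, by simpa using hi⟩

/-- The geometric realization of a finite abstract simplicial complex, in barycentric
coordinates. -/
def realization {V : Type*} [Fintype V] (K : AbstractSimplicialComplex V) : Set (V → ℝ) :=
  {x | (∀ v, 0 ≤ x v) ∧ ∑ v, x v = 1 ∧ ∃ s ∈ K.faces, (s : Set V) = Function.support x}

/-- The directed edge `(u, v)` belongs to the boundary of the oriented triangle `i`
(indices in `Fin 3` are cyclic). -/
def OrientedTriangles.HasDirectedEdge (T : OrientedTriangles) (i : T.ι) (u v : T.V) : Prop :=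
  ∃ k : Fin 3, T.tri i k = u ∧ T.tri i (k + 1) = v

/-- A triangulation of a square: an oriented simplicial complex homeomorphic to a disk, with
exactly four vertices on the boundary, labelled in the cyclic order given by the orientation. -/
structure Triangulation extends OrientedTriangles where
  homeomorphic_disk : Nonempty (realization toOrientedTriangles.complex ≃ₜ
    Metric.closedBall (0 : EuclideanSpace ℝ (Fin 2)) 1)
  /-- The orientation is coherent: triangles that share an edge induce opposite directions on
  it. -/
  coherent : ∀ i j u v, toOrientedTriangles.HasDirectedEdge i u v →
    toOrientedTriangles.HasDirectedEdge j u v → i = j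
  /-- the corners `𝐩, 𝐪, 𝐫, 𝐬` -/
  corner : Fin 4 → V
  corner_injective : Function.Injective corner
  /-- The boundary (the edges that lie in only one triangle, with the induced direction) is the
  cycle `𝐩 → 𝐪 → 𝐫 → 𝐬 → 𝐩`. -/
  boundary_iff : ∀ u v,
    ((∃ i, toOrientedTriangles.HasDirectedEdge i u v) ∧
      ¬ ∃ i, toOrientedTriangles.HasDirectedEdge i v u) ↔
    ∃ k : Fin 4, corner k = u ∧ corner (k + 1) = v

/-! ### Drawings, areas and the area polynomial -/

/-- The space of drawings: maps from the vertices to `ℂ²` that send the corners to the vertices of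
a possibly degenerate parallelogram. -/
def drawings (T : Triangulation) : Set (T.V → Fin 2 → ℂ) :=
  {ρ | ρ (T.corner 0) + ρ (T.corner 2) = ρ (T.corner 1) + ρ (T.corner 3)}

/-- The area of an ordered triangle in `ℂ²`. -/
def area (a b c : Fin 2 → ℂ) : ℂ :=
  (1 / 2) * Matrix.det !![1, 1, 1; a 0, b 0, c 0; a 1, b 1, c 1]

/-- The tuple of areas of the triangles in a drawing. -/
def areaTuple (T : Triangulation) (ρ : T.V → Fin 2 → ℂ) : T.ι → ℂ :=
  fun i => area (ρ (T.tri i 0)) (ρ (T.tri i 1)) (ρ (T.tri i 2))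

/-- `p` is an area polynomial of `T`: a homogeneous integer polynomial whose coefficients have no
common factor and which defines the area variety, i.e. it generates over `ℂ` the ideal of all
polynomials that vanish on the area tuples of all drawings.  (The set of area tuples is stable
under scaling, so this is the homogeneous ideal of the closure of its image in projective
space.) -/
def IsAreaPolynomial (T : Triangulation) (p : MvPolynomial T.ι ℤ) : Prop :=
  (∃ d, p.IsHomogeneous d) ∧
  (∀ c : ℤ, C c ∣ p → IsUnit c) ∧
  vanishingIdeal ℂ (areaTuple T '' drawings T) = Ideal.span {map (Int.castRingHom ℂ) p}

/-! ### The area encyclopedia -/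

open Classical in
/-- The specialization `p|_L`: substitute `0` for all variables that are not in `L`. -/
def specialize {σ R : Type*} [CommRing R] (L : Finset σ) (p : MvPolynomial σ R) :
    MvPolynomial L R :=
  aeval (fun i => if h : i ∈ L then X ⟨i, h⟩ else 0) p

/-- Equality of polynomials in `l` variables up to a nonzero scalar and a permutation of the
variables. -/
def PolyEquiv {K : Type*} [Field K] {l : ℕ} (q q' : MvPolynomial (Fin l) K) : Prop :=
  ∃ c : K, c ≠ 0 ∧ ∃ π : Equiv.Perm (Fin l), q' = C c * rename π q

/-- `q` is an irreducible factor of an `l`-variable specialization of an area polynomial.  The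
variables of the specialization, which are the elements of `L`, are numbered by `e`. -/
def IsAreaFactor {K : Type*} [Field K] {l : ℕ} (q : MvPolynomial (Fin l) K) : Prop :=
  ∃ (T : Triangulation) (p : MvPolynomial T.ι ℤ) (L : Finset T.ι) (e : L ≃ Fin l),
    IsAreaPolynomial T p ∧ Irreducible q ∧
      q ∣ rename e (specialize L (map (Int.castRingHom K) p))

/-- The `l`-th volume `ℰ_l` of the area encyclopedia over `K`, for positive `l`, given as the set
of all polynomials whose equivalence class belongs to it. -/
def encyclopedia (K : Type*) [Field K] (l : ℕ) : Set (MvPolynomial (Fin l) K) :=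
  {q | 0 < l ∧ ∃ q', PolyEquiv q' q ∧ IsAreaFactor q'}

/-- `q'` is obtained from `q` by substituting `X' + X''` for the variable `X i`.  The variables of
`q'` are numbered by `e`: the variable `X j` with `j ≠ i` becomes `X (e (some j))`, and `X'`, `X''`
are `X (e (some i))` and `X (e none)`. -/
def IsAlgSubdivision {K : Type*} [Field K] {n : ℕ}
    (q : MvPolynomial (Fin n) K) (q' : MvPolynomial (Fin (n + 1)) K) : Prop :=
  ∃ (i : Fin n) (e : Option (Fin n) ≃ Fin (n + 1)),
    q' = aeval (fun j => if j = i then X (e (some i)) + X (e none) else X (e (some j))) q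

/-- The same relation between polynomials in any numbers of variables. -/
inductive SubdivisionStep {K : Type*} [Field K] :
    (Σ n : ℕ, MvPolynomial (Fin n) K) → (Σ n : ℕ, MvPolynomial (Fin n) K) → Prop
  | mk {n : ℕ} (q : MvPolynomial (Fin n) K) (q' : MvPolynomial (Fin (n + 1)) K)
      (h : IsAlgSubdivision q q') : SubdivisionStep ⟨n, q⟩ ⟨n + 1, q'⟩

/-- The `l`-th volume of the abridged encyclopedia: the members of `ℰ_l` that are not, up to
equivalence, an algebraic subdivision of a member of `ℰ_{l-1}`. -/
def abridged (K : Type*) [Field K] (l : ℕ) : Set (MvPolynomial (Fin l) K) :=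
  {q | q ∈ encyclopedia K l ∧
    ¬ ∃ r ∈ encyclopedia K (l - 1), ∃ q', PolyEquiv q' q ∧ SubdivisionStep ⟨l - 1, r⟩ ⟨l, q'⟩}

end AreaEncyclopedia

end

/-!
A map `φ` between index sets acts on polynomials by substituting the sum of the variables in the
fiber of `φ` at `i` for the variable `X i`. This operation is functorial, and it covers everything
in sight: for an injective `φ` it is a specialization, and an algebraic subdivision is the case of a
surjection that identifies two indices.

The geometric input is the subdivision of a triangle `Δ` by a new vertex in its interior. If the
area of `Δ` is not zero, then the areas of the three pieces of `Δ` can be prescribed arbitrarily as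
long as their sum is the area of `Δ`. As the area variety is irreducible, the case of area zero
can be ignored, so the area polynomial of the new triangulation arises from `p_T` by substituting a
sum of three variables for `A_Δ`. Setting one of the three to zero yields an algebraic subdivision
at `Δ`; conversely, setting one of the two variables `X'`, `X''` to zero undoes a subdivision.
Irreducibility is not affected by the substitution along a surjection, which is the composition of
an inclusion of variables and a linear change of coordinates.
-/

noncomputable section

namespace AreaEncyclopedia

open MvPolynomial

/-! ### Sums over fibers -/

section FiberSum

variable {ι τ υ M : Type*} [Fintype τ] [AddCommMonoid M]

open Classical in
/-- The push-forward of the tuple `x` along `φ`: its value at `i` is the sum of the entries of `x`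
over the fiber of `φ` at `i`. -/
def fiberSum (φ : τ → ι) (x : τ → M) : ι → M :=
  fun i => ∑ t with φ t = i, x t

lemma map_fiberSum {N F : Type*} [AddCommMonoid N] [FunLike F M N] [AddMonoidHomClass F M N]
    (g : F) (φ : τ → ι) (x : τ → M) (i : ι) :
    g (fiberSum φ x i) = fiberSum φ (fun t => g (x t)) i :=
  map_sum g _ _

lemma fiberSum_fiberSum [Fintype υ] (φ : τ → ι) (ψ : υ → τ) (x : υ → M) :
    fiberSum φ (fiberSum ψ x) = fiberSum (φ ∘ ψ) x := by
  classical
  ext i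
  simp only [fiberSum]
  rw [← Finset.sum_fiberwise_of_maps_to (s := {u | (φ ∘ ψ) u = i}) (t := {t | φ t = i}) (g := ψ)
    (by simp)]
  refine Finset.sum_congr rfl fun t ht => Finset.sum_congr ?_ fun _ _ => rfl
  ext u
  have hφt : φ t = i := by simpa using ht
  simpa using fun hu : ψ u = t => hu ▸ hφt

lemma fiberSum_eq_sum_of_range_eq {κ : Type*} [Fintype κ] {φ : τ → ι} {i : ι} {g : κ → τ}
    (hg : Function.Injective g) (hrange : Set.range g = φ ⁻¹' {i}) (x : τ → M) :
    fiberSum φ x i = ∑ k, x (g k) := by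
  classical
  have hmem (t : τ) : t ∈ Set.range g ↔ φ t = i := by simp [hrange]
  rw [fiberSum, Finset.sum_filter]
  refine (Fintype.sum_of_injective g hg _ _ (fun t ht => ?_) fun k => ?_).symm
  · exact if_neg fun h => ht ((hmem t).2 h)
  · rw [if_pos ((hmem _).1 ⟨k, rfl⟩)]

lemma fiberSum_eq_single {φ : τ → ι} {t : τ} (ht : ∀ u, φ u = φ t → u = t) (x : τ → M) :
    fiberSum φ x (φ t) = x t :=
  Finset.sum_eq_single t (fun u hu hne => absurd (ht u (by simpa using hu)) hne) (by simp)

lemma fiberSum_apply_of_injective {φ : τ → ι} (hφ : Function.Injective φ) (x : τ → M) (t : τ) :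
    fiberSum φ x (φ t) = x t :=
  fiberSum_eq_single (fun _ h => hφ h) x

lemma fiberSum_id (x : τ → M) : fiberSum id x = x :=
  funext (fiberSum_apply_of_injective Function.injective_id x)

lemma fiberSum_apply_of_notMem_range {φ : τ → ι} {i : ι} (hi : i ∉ Set.range φ) (x : τ → M) :
    fiberSum φ x i = 0 :=
  Finset.sum_eq_zero fun t ht => absurd ⟨t, by simpa using ht⟩ hi

lemma fiberSum_equiv (e : τ ≃ ι) (x : τ → M) (i : ι) : fiberSum e x i = x (e.symm i) := by
  simpa using fiberSum_apply_of_injective e.injective x (e.symm i)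

end FiberSum

section FiberSubst

variable {ι τ υ R : Type*} [Fintype τ] [CommSemiring R]

/-- The substitution of `∑ t ∈ φ⁻¹(i), X t` for each variable `X i`. For an injective `φ` this sets
the variables outside the range of `φ` to zero; for a surjective `φ` it is an iterated algebraic
subdivision. -/
def fiberSubst (φ : τ → ι) : MvPolynomial ι R →ₐ[R] MvPolynomial τ R :=
  aeval (fiberSum φ X)

lemma fiberSubst_X (φ : τ → ι) (i : ι) :
    fiberSubst φ (X i : MvPolynomial ι R) = fiberSum φ X i :=
  aeval_X _ i

lemma aeval_fiberSubst {A : Type*} [CommSemiring A] [Algebra R A] (φ : τ → ι) (x : τ → A)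
    (p : MvPolynomial ι R) :
    aeval x (fiberSubst φ p) = aeval (fiberSum φ x) p := by
  rw [fiberSubst, ← AlgHom.comp_apply, comp_aeval]
  congr 2
  ext i
  simp only [map_fiberSum, aeval_X]

lemma fiberSubst_id (p : MvPolynomial τ R) : fiberSubst id p = p := by
  rw [fiberSubst, fiberSum_id, aeval_X_left_apply]

lemma fiberSubst_fiberSubst [Fintype υ] (φ : τ → ι) (ψ : υ → τ) (p : MvPolynomial ι R) :
    fiberSubst ψ (fiberSubst φ p) = fiberSubst (φ ∘ ψ) p :=
  (aeval_fiberSubst φ (fiberSum ψ X) p).trans (by rw [fiberSum_fiberSum, fiberSubst])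

lemma fiberSubst_fiberSubst_of_rightInverse [Fintype ι] {φ : τ → ι} {r : ι → τ}
    (hr : Function.RightInverse r φ) (p : MvPolynomial ι R) :
    fiberSubst r (fiberSubst φ p) = p := by
  rw [fiberSubst_fiberSubst, hr.comp_eq_id, fiberSubst_id]

lemma fiberSubst_equiv (e : τ ≃ ι) (p : MvPolynomial ι R) :
    fiberSubst e p = rename e.symm p := by
  rw [fiberSubst, rename_eq_aeval]
  congr 2
  ext1 i
  exact fiberSum_equiv e X i

lemma map_fiberSubst {S : Type*} [CommSemiring S] (f : R →+* S) (φ : τ → ι)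
    (p : MvPolynomial ι R) :
    map f (fiberSubst φ p) = fiberSubst φ (map f p) := by
  refine (map_bind₁ f (fiberSum φ X) p).trans (congrArg (bind₁ · (map f p)) ?_)
  ext1 i
  simp only [map_fiberSum, map_X]

lemma isHomogeneous_fiberSubst {p : MvPolynomial ι R} {d : ℕ} (hp : p.IsHomogeneous d)
    (φ : τ → ι) : (fiberSubst φ p).IsHomogeneous d :=
  one_mul d ▸ hp.aeval (fiberSum φ X) fun _ =>
    IsHomogeneous.sum _ _ _ fun _ _ => isHomogeneous_X _ _

lemma C_dvd_of_C_dvd_fiberSubst {φ : τ → ι} (hφ : Function.Surjective φ) {c : R}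
    {p : MvPolynomial ι R} (h : C c ∣ fiberSubst φ p) : C c ∣ p := by
  have := Finite.of_surjective φ hφ
  have := Fintype.ofFinite ι
  simpa only [algHom_C, algebraMap_eq,
    fiberSubst_fiberSubst_of_rightInverse (Function.rightInverse_surjInv hφ)]
    using map_dvd (fiberSubst (Function.surjInv hφ)) h

end FiberSubst

section Prime

variable {ι τ R : Type*} [Fintype τ] [CommRing R]

open Classical in
/-- For a section `r` of `φ`, the sum of the variables in the fiber of `φ` through `t` other than
`X t` if `t` lies in the range of `r`, and `0` otherwise. -/
def complementSum (φ : τ → ι) (r : ι → τ) (t : τ) : MvPolynomial τ R :=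
  if r (φ t) = t then ∑ u with φ u = φ t ∧ u ≠ t, X u else 0

lemma bind₁_complementSum {φ : τ → ι} {r : ι → τ} {x : τ → MvPolynomial τ R}
    (hx : ∀ u, r (φ u) ≠ u → x u = X u) (t : τ) :
    bind₁ x (complementSum φ r t) = complementSum φ r t := by
  classical
  by_cases ht : r (φ t) = t
  · simp only [complementSum, if_pos ht, map_sum, bind₁_X_right]
    refine Finset.sum_congr rfl fun u hu => hx u fun hru => ?_
    obtain ⟨hφ, hne⟩ := Finset.mem_filter_univ u |>.1 hu
    exact hne (hru.symm.trans ((congrArg r hφ).trans ht))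
  · simp [complementSum, ht]

lemma complementSum_of_ne {φ : τ → ι} {r : ι → τ} {t : τ} (ht : r (φ t) ≠ t) :
    (complementSum φ r t : MvPolynomial τ R) = 0 :=
  if_neg ht

lemma X_add_complementSum {φ : τ → ι} {r : ι → τ} (hr : Function.RightInverse r φ) (i : ι) :
    X (r i) + complementSum φ r (r i) = (fiberSum φ X i : MvPolynomial τ R) := by
  classical
  simp only [complementSum, fiberSum, hr i, if_true]
  rw [← Finset.add_sum_erase {t | φ t = i} X (a := r i) (by simp [hr i])]
  congr 2
  ext u
  simp [and_comm]

variable (R) in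
/-- The linear change of coordinates that takes `X (r i)` to the sum of the variables in the fiber
of `φ` at `i`, for a section `r` of `φ`, and fixes the variables outside the range of `r`. -/
def fiberShear (φ : τ → ι) (r : ι → τ) : MvPolynomial τ R ≃ₐ[R] MvPolynomial τ R :=
  AlgEquiv.ofAlgHom
    (bind₁ fun t => X t + complementSum φ r t)
    (bind₁ fun t => X t - complementSum φ r t)
    (by
      ext1 t
      have hfix := bind₁_complementSum (R := R) (φ := φ) (r := r)
        (x := fun t => X t + complementSum φ r t) fun u hu => by simp [complementSum_of_ne hu]
      simp [hfix])
    (by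
      ext1 t
      have hfix := bind₁_complementSum (R := R) (φ := φ) (r := r)
        (x := fun t => X t - complementSum φ r t) fun u hu => by simp [complementSum_of_ne hu]
      simp [hfix])

lemma fiberShear_rename {φ : τ → ι} {r : ι → τ} (hr : Function.RightInverse r φ)
    (p : MvPolynomial ι R) : fiberShear R φ r (rename r p) = fiberSubst φ p := by
  refine (aeval_rename _ _ _).trans (congrArg (aeval · p) ?_)
  ext1 i
  exact X_add_complementSum hr i

lemma prime_rename_iff_of_injective {σ : Type*} {f : ι → σ} (hf : Function.Injective f)
    {p : MvPolynomial ι R} : Prime (rename f p) ↔ Prime p := by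
  rw [← MulEquiv.prime_iff (renameEquiv R (Equiv.ofInjective f hf)),
    ← prime_rename_iff (Set.range f), renameEquiv_apply, rename_rename]
  rfl

lemma prime_fiberSubst_iff {φ : τ → ι} (hφ : Function.Surjective φ) {p : MvPolynomial ι R} :
    Prime (fiberSubst φ p) ↔ Prime p := by
  have hr := Function.rightInverse_surjInv hφ
  rw [← fiberShear_rename hr, MulEquiv.prime_iff, prime_rename_iff_of_injective hr.injective]

lemma irreducible_fiberSubst_iff [IsDomain R] [UniqueFactorizationMonoid R] {φ : τ → ι}
    (hφ : Function.Surjective φ) {p : MvPolynomial ι R} :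
    Irreducible (fiberSubst φ p) ↔ Irreducible p := by
  simp only [UniqueFactorizationMonoid.irreducible_iff_prime, prime_fiberSubst_iff hφ]

end Prime

/-! ### Vanishing ideals -/

section FiberShift

variable {ι τ : Type*} [Fintype ι] [Fintype τ]

/-- For a section `r` of `φ`, the tuple `y` moved into the fiber of `fiberSum φ` over `s`. -/
def fiberShift {M : Type*} [AddCommGroup M] (φ : τ → ι) (r : ι → τ) (s : ι → M) (y : τ → M) :
    τ → M :=
  fun t => y t + fiberSum r (fun i => s i - fiberSum φ y i) t

lemma fiberSum_fiberShift {M : Type*} [AddCommGroup M] {φ : τ → ι} {r : ι → τ}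
    (hr : Function.RightInverse r φ) (s : ι → M) (y : τ → M) :
    fiberSum φ (fiberShift φ r s y) = s := by
  ext i
  have hshift := congrFun (fiberSum_fiberSum φ r fun i => s i - fiberSum φ y i) i
  rw [hr.comp_eq_id, fiberSum_id] at hshift
  simp only [fiberSum, fiberShift, Finset.sum_add_distrib] at hshift ⊢
  rw [hshift, add_sub_cancel]

lemma fiberShift_fiberSum {M : Type*} [AddCommGroup M] (φ : τ → ι) (r : ι → τ) (y : τ → M) :
    fiberShift φ r (fiberSum φ y) y = y := by
  ext t
  simp [fiberShift, fiberSum]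

variable {k : Type*} [Field k]

/-- The polynomial `f` at the generic point of the source of `fiberSum φ`, written in terms of its
image under `fiberSum φ` (the coefficients) and a free parameter (the variables). -/
def fiberExpand (φ : τ → ι) (r : ι → τ) :
    MvPolynomial τ k →ₐ[k] MvPolynomial τ (MvPolynomial ι k) :=
  aeval (fiberShift φ r (fun i => C (X i)) X)

lemma aevalTower_fiberExpand {A : Type*} [CommRing A] [Algebra k A] (φ : τ → ι) (r : ι → τ)
    (g : MvPolynomial ι k →ₐ[k] A) (y : τ → A) (f : MvPolynomial τ k) :
    aevalTower g y (fiberExpand φ r f) = aeval (fiberShift φ r (fun i => g (X i)) y) f := by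
  rw [fiberExpand, ← AlgHom.comp_apply, comp_aeval]
  congr 2
  ext1 t
  simp only [fiberShift, map_add, map_sub, map_fiberSum, aevalTower_X, aevalTower_C]

lemma coeff_fiberExpand_mem_vanishingIdeal [Infinite k] {φ : τ → ι} {r : ι → τ}
    (hr : Function.RightInverse r φ) {S : Set (ι → k)} {f : MvPolynomial τ k}
    (hf : f ∈ vanishingIdeal k (fiberSum φ ⁻¹' S)) (m : τ →₀ ℕ) :
    (fiberExpand φ r f).coeff m ∈ vanishingIdeal k S := by
  intro s hs
  suffices hzero : map (aeval s : MvPolynomial ι k →ₐ[k] k).toRingHom (fiberExpand φ r f) = 0 by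
    have hcoeff := congrArg (coeff m) hzero
    rwa [coeff_map, coeff_zero] at hcoeff
  refine MvPolynomial.funext fun y => ?_
  have heval := aevalTower_fiberExpand φ r (aeval s) y f
  simp only [aeval_X] at heval
  rw [map_zero, eval_map]
  refine heval.trans (hf _ ?_)
  rwa [Set.mem_preimage, fiberSum_fiberShift hr]

end FiberShift

section VanishingIdeal

variable {ι k : Type*} [Field k]

lemma vanishingIdeal_preimage_fiberSum {τ : Type*} [Fintype τ] [Infinite k] {φ : τ → ι}
    (hφ : Function.Surjective φ) (S : Set (ι → k)) :
    vanishingIdeal k (fiberSum φ ⁻¹' S) = (vanishingIdeal k S).map (fiberSubst φ) := by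
  have := Finite.of_surjective φ hφ
  have := Fintype.ofFinite ι
  have hr := Function.rightInverse_surjInv hφ
  set r := Function.surjInv hφ
  refine le_antisymm (fun f hf => ?_) (Ideal.map_le_iff_le_comap.2 fun p hp x hx => ?_)
  · let collapse : MvPolynomial τ (MvPolynomial ι k) →ₐ[k] MvPolynomial τ k :=
      aevalTower (fiberSubst φ) X
    have hcollapse : collapse (fiberExpand φ r f) = f := by
      simp only [collapse, aevalTower_fiberExpand, fiberSubst_X]
      rw [fiberShift_fiberSum, aeval_X_left_apply]
    have hmem := Ideal.mem_map_of_mem collapse.toRingHom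
      (mem_map_C_iff.2 (coeff_fiberExpand_mem_vanishingIdeal hr hf))
    have hcomp : collapse.toRingHom.comp C = (fiberSubst φ).toRingHom :=
      RingHom.ext fun p => aevalTower_C _ _ p
    rw [Ideal.map_map, hcomp] at hmem
    exact hcollapse ▸ hmem
  · rw [aeval_fiberSubst]
    exact hp _ hx

lemma isPrime_vanishingIdeal_of_curves [Infinite k] {S : Set (ι → k)} (hS : S.Nonempty)
    (hcurve : ∀ x ∈ S, ∀ y ∈ S, ∃ P : ι → Polynomial k, (∀ t, (fun i => (P i).eval t) ∈ S) ∧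
      (∀ i, (P i).eval 0 = x i) ∧ ∀ i, (P i).eval 1 = y i) :
    (vanishingIdeal k S).IsPrime := by
  refine ⟨?_, fun {f g} hfg => ?_⟩
  · obtain ⟨x, hx⟩ := hS
    exact (Ideal.ne_top_iff_one _).2 fun h => one_ne_zero ((map_one _).symm.trans (h x hx))
  by_contra! ⟨hf, hg⟩
  simp only [mem_vanishingIdeal_iff, not_forall] at hf hg
  obtain ⟨x, hx, hfx⟩ := hf
  obtain ⟨y, hy, hgy⟩ := hg
  obtain ⟨P, hPS, hP0, hP1⟩ := hcurve x hx y hy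
  have heval (p : MvPolynomial ι k) (t : k) :
      (aeval P p).eval t = aeval (fun i => (P i).eval t) p := by
    rw [← Polynomial.coe_aeval_eq_eval, ← AlgHom.comp_apply, comp_aeval]
  have hmul : aeval P f * aeval P g = 0 := Polynomial.funext fun t => by
    rw [← map_mul, heval, hfg _ (hPS t), Polynomial.eval_zero]
  rcases mul_eq_zero.1 hmul with h | h
  · refine hfx ?_
    rw [← funext hP0, ← heval, h, Polynomial.eval_zero]
  · refine hgy ?_
    rw [← funext hP1, ← heval, h, Polynomial.eval_zero]

lemma vanishingIdeal_inter_setOf_ne_zero {S : Set (ι → k)} (hS : (vanishingIdeal k S).IsPrime)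
    {g : MvPolynomial ι k} (hg : g ∉ vanishingIdeal k S) :
    vanishingIdeal k (S ∩ {x | aeval x g ≠ 0}) = vanishingIdeal k S := by
  refine le_antisymm (fun f hf => ?_) (vanishingIdeal_anti_mono Set.inter_subset_left)
  refine (hS.mem_or_mem (x := f) (y := g) fun x hx => ?_).resolve_right hg
  rw [map_mul]
  by_cases hgx : aeval x g = 0
  · rw [hgx, mul_zero]
  · rw [hf x ⟨hx, hgx⟩, zero_mul]

end VanishingIdeal


/-! ### Central subdivision of a triangle -/

section ConeTriangle

variable {V : Type*} {t : Fin 3 → V}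

/-- The cone over the edge of the triangle `t` from `t k` to `t (k + 1)`, whose apex is the new
vertex `none`. -/
def coneTriangle (t : Fin 3 → V) (k : Fin 3) : Fin 3 → Option V :=
  ![some (t k), some (t (k + 1)), none]

lemma some_mem_range_coneTriangle {k : Fin 3} {v : V} :
    some v ∈ Set.range (coneTriangle t k) ↔ v = t k ∨ v = t (k + 1) := by
  simp [coneTriangle, or_comm]

lemma none_mem_range_coneTriangle (k : Fin 3) : none ∈ Set.range (coneTriangle t k) :=
  ⟨2, rfl⟩

lemma coneTriangle_injective (ht : Function.Injective t) (k : Fin 3) :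
    Function.Injective (coneTriangle t k) := by
  have hne : t k ≠ t (k + 1) := ht.ne (by simp)
  intro a b
  fin_cases a <;> fin_cases b <;> simp [coneTriangle, hne, hne.symm]

lemma some_apply_mem_range_coneTriangle_iff (ht : Function.Injective t) {k l : Fin 3} :
    some (t l) ∈ Set.range (coneTriangle t k) ↔ l ≠ k + 2 := by
  rw [some_mem_range_coneTriangle, ht.eq_iff, ht.eq_iff]
  revert k l
  decide

end ConeTriangle

namespace OrientedTriangles

/-- The complex obtained from `T` by subdividing the triangle `i₀` with a new vertex `none` in its
interior. -/
def centralSubdivision (T : OrientedTriangles) (i₀ : T.ι) : OrientedTriangles where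
  V := Option T.V
  ι := {j // j ≠ i₀} ⊕ Fin 3
  fintypeι := by classical infer_instance
  tri := Sum.elim (fun j => some ∘ T.tri j) (coneTriangle (T.tri i₀))
  tri_injective
    | .inl j => (Option.some_injective _).comp (T.tri_injective j)
    | .inr k => coneTriangle_injective (T.tri_injective i₀) k
  eq_of_range_eq := by
    have hmixed (j : {j // j ≠ i₀}) (k : Fin 3) :
        Set.range (some ∘ T.tri j) ≠ Set.range (coneTriangle (T.tri i₀) k) := fun h => by
      have hnone : none ∈ Set.range (some ∘ T.tri j) := h ▸ none_mem_range_coneTriangle k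
      simp at hnone
    rintro (j | k) (j' | k') h
    · refine congrArg Sum.inl (Subtype.ext (T.eq_of_range_eq _ _ ?_))
      refine (Option.some_injective T.V).image_injective ?_
      rw [← Set.range_comp, ← Set.range_comp]
      exact h
    · exact absurd h (hmixed j k')
    · exact absurd h.symm (hmixed j' k)
    · have hmem (l : Fin 3) : l ≠ k + 2 ↔ l ≠ k' + 2 := by
        simp only [← some_apply_mem_range_coneTriangle_iff (T.tri_injective i₀)]
        exact Set.ext_iff.1 h _
      exact congrArg Sum.inr (add_right_cancel (not_ne_iff.1 ((hmem (k + 2)).not.1 (by simp))))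
  exists_mem_range := by
    rintro (_ | v)
    · exact ⟨.inr 0, none_mem_range_coneTriangle 0⟩
    · obtain ⟨j, k, rfl⟩ := T.exists_mem_range v
      rcases eq_or_ne j i₀ with rfl | hj
      · exact ⟨.inr k, 0, rfl⟩
      · exact ⟨.inl ⟨j, hj⟩, k, rfl⟩

variable {T : OrientedTriangles} {i₀ : T.ι}

/-- The triangle of `T` that contains a given triangle of a central subdivision of `T`. -/
def parentTriangle : (T.centralSubdivision i₀).ι → T.ι :=
  Sum.elim Subtype.val fun _ => i₀

lemma parentTriangle_surjective : Function.Surjective (parentTriangle (i₀ := i₀)) := fun j => by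
  rcases eq_or_ne j i₀ with rfl | hj
  exacts [⟨.inr 0, rfl⟩, ⟨.inl ⟨j, hj⟩, rfl⟩]

lemma mem_range_tri_parentTriangle {i : (T.centralSubdivision i₀).ι} {v : T.V}
    (hv : some v ∈ Set.range ((T.centralSubdivision i₀).tri i)) :
    v ∈ Set.range (T.tri (parentTriangle i)) := by
  rcases i with j | k
  · obtain ⟨l, hl⟩ := hv
    exact ⟨l, Option.some_injective _ hl⟩
  · rcases some_mem_range_coneTriangle.1 hv with rfl | rfl
    exacts [⟨k, rfl⟩, ⟨k + 1, rfl⟩]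

lemma parentTriangle_eq_of_none_mem_range {i : (T.centralSubdivision i₀).ι}
    (hi : none ∈ Set.range ((T.centralSubdivision i₀).tri i)) : parentTriangle i = i₀ := by
  rcases i with j | k
  · obtain ⟨l, hl⟩ := hi
    cases hl
  · rfl

lemma fiberSum_parentTriangle_self {M : Type*} [AddCommMonoid M]
    (x : (T.centralSubdivision i₀).ι → M) : fiberSum parentTriangle x i₀ = ∑ k, x (.inr k) := by
  have hrange : Set.range (Sum.inr : Fin 3 → (T.centralSubdivision i₀).ι) =
      parentTriangle ⁻¹' {i₀} := by
    ext t
    rcases t with j | k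
    · exact iff_of_false (fun ⟨_, h⟩ => Sum.inr_ne_inl h) j.2
    · exact iff_of_true ⟨k, rfl⟩ rfl
  exact fiberSum_eq_sum_of_range_eq (τ := (T.centralSubdivision i₀).ι) Sum.inr_injective hrange x

lemma fiberSum_parentTriangle_of_ne {M : Type*} [AddCommMonoid M]
    (x : (T.centralSubdivision i₀).ι → M) (j : {j // j ≠ i₀}) :
    fiberSum parentTriangle x j = x (.inl j) := by
  refine fiberSum_eq_single (φ := parentTriangle) (t := .inl j) ?_ x
  rintro (j' | k) h
  · exact congrArg Sum.inl (Subtype.ext h)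
  · exact absurd h.symm j.2

lemma hasDirectedEdge_none_left_iff {i : (T.centralSubdivision i₀).ι} {v : Option T.V} :
    (T.centralSubdivision i₀).HasDirectedEdge i none v ↔
      ∃ k, i = .inr k ∧ v = some (T.tri i₀ k) := by
  constructor
  · rintro ⟨l, hl, rfl⟩
    rcases i with j | k
    · cases hl
    · fin_cases l
      · cases hl
      · cases hl
      · exact ⟨k, rfl, rfl⟩
  · rintro ⟨k, rfl, rfl⟩
    exact ⟨2, rfl, rfl⟩

lemma hasDirectedEdge_none_right_iff {i : (T.centralSubdivision i₀).ι} {u : Option T.V} :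
    (T.centralSubdivision i₀).HasDirectedEdge i u none ↔
      ∃ k, i = .inr k ∧ u = some (T.tri i₀ (k + 1)) := by
  constructor
  · rintro ⟨l, rfl, hl⟩
    rcases i with j | k
    · cases hl
    · fin_cases l
      · cases hl
      · exact ⟨k, rfl, rfl⟩
      · cases hl
  · rintro ⟨k, rfl, rfl⟩
    exact ⟨1, rfl, rfl⟩

lemma hasDirectedEdge_some_some_iff {i : (T.centralSubdivision i₀).ι} {u v : T.V} :
    (T.centralSubdivision i₀).HasDirectedEdge i (some u) (some v) ↔
      T.HasDirectedEdge (parentTriangle i) u v ∧ ∀ k, i = .inr k → u = T.tri i₀ k := by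
  rcases i with j | k
  · constructor
    · rintro ⟨l, hu, hv⟩
      exact ⟨⟨l, Option.some_injective _ hu, Option.some_injective _ hv⟩, nofun⟩
    · rintro ⟨⟨l, rfl, rfl⟩, -⟩
      exact ⟨l, rfl, rfl⟩
  · constructor
    · rintro ⟨l, hu, hv⟩
      fin_cases l
      · cases hu
        cases hv
        exact ⟨⟨k, rfl, rfl⟩, by rintro _ ⟨⟩; rfl⟩
      · cases hv
      · cases hu
    · rintro ⟨⟨l, rfl, rfl⟩, hk⟩
      obtain rfl := T.tri_injective i₀ (hk k rfl)
      exact ⟨0, rfl, rfl⟩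

lemma exists_hasDirectedEdge_some_some_iff {u v : T.V} :
    (∃ i, (T.centralSubdivision i₀).HasDirectedEdge i (some u) (some v)) ↔
      ∃ i, T.HasDirectedEdge i u v := by
  constructor
  · rintro ⟨i, hi⟩
    exact ⟨_, (hasDirectedEdge_some_some_iff.1 hi).1⟩
  · rintro ⟨j, k, rfl, rfl⟩
    rcases eq_or_ne j i₀ with rfl | hj
    exacts [⟨.inr k, 0, rfl, rfl⟩, ⟨.inl ⟨j, hj⟩, k, rfl, rfl⟩]

lemma exists_hasDirectedEdge_none_left_iff_none_right {u : Option T.V} :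
    (∃ i, (T.centralSubdivision i₀).HasDirectedEdge i none u) ↔
      ∃ i, (T.centralSubdivision i₀).HasDirectedEdge i u none := by
  simp only [hasDirectedEdge_none_left_iff, hasDirectedEdge_none_right_iff]
  constructor
  · rintro ⟨_, k, -, rfl⟩
    exact ⟨_, k - 1, rfl, by rw [sub_add_cancel]⟩
  · rintro ⟨_, k, -, rfl⟩
    exact ⟨_, k + 1, rfl, rfl⟩

lemma centralSubdivision_coherent
    (hT : ∀ i j u v, T.HasDirectedEdge i u v → T.HasDirectedEdge j u v → i = j)
    (i j : (T.centralSubdivision i₀).ι) (u v : Option T.V)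
    (hi : (T.centralSubdivision i₀).HasDirectedEdge i u v)
    (hj : (T.centralSubdivision i₀).HasDirectedEdge j u v) : i = j := by
  have htri := T.tri_injective i₀
  rcases u with _ | u
  · obtain ⟨k, rfl, hk⟩ := hasDirectedEdge_none_left_iff.1 hi
    obtain ⟨l, rfl, hl⟩ := hasDirectedEdge_none_left_iff.1 hj
    exact congrArg Sum.inr (htri (Option.some_injective _ (hk.symm.trans hl)))
  rcases v with _ | v
  · obtain ⟨k, rfl, hk⟩ := hasDirectedEdge_none_right_iff.1 hi
    obtain ⟨l, rfl, hl⟩ := hasDirectedEdge_none_right_iff.1 hj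
    exact congrArg Sum.inr
      (add_right_cancel (htri (Option.some_injective _ (hk.symm.trans hl))))
  obtain ⟨hi, hi'⟩ := hasDirectedEdge_some_some_iff.1 hi
  obtain ⟨hj, hj'⟩ := hasDirectedEdge_some_some_iff.1 hj
  have hparent := hT _ _ _ _ hi hj
  rcases i with i | k <;> rcases j with j | l
  · exact congrArg Sum.inl (Subtype.ext hparent)
  · exact absurd hparent i.2
  · exact absurd hparent.symm j.2
  · exact congrArg Sum.inr (htri ((hi' k rfl).symm.trans (hj' l rfl)))

/-! ### The realization of a central subdivision -/

lemma mem_realization_complex_iff {x : T.V → ℝ} :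
    x ∈ realization T.complex ↔
      (∀ v, 0 ≤ x v) ∧ ∑ v, x v = 1 ∧ ∃ i, ∀ v, x v ≠ 0 → v ∈ Set.range (T.tri i) := by
  classical
  refine and_congr_right fun _ => and_congr_right fun hsum => ⟨?_, ?_⟩
  · rintro ⟨s, ⟨_, i, hi⟩, hs⟩
    exact ⟨i, fun v hv => hi (hs ▸ hv)⟩
  · rintro ⟨i, hi⟩
    obtain ⟨v, -, hv⟩ := Finset.exists_ne_zero_of_sum_ne_zero (hsum ▸ one_ne_zero)
    refine ⟨({v | x v ≠ 0} : Finset T.V), ⟨⟨v, by simpa using hv⟩, i, fun w hw => ?_⟩, ?_⟩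
    · exact hi w (by simpa using hw)
    · ext w
      simp

lemma exists_tri_notMem_range {i j : T.ι} (hij : i ≠ j) : ∃ k, T.tri i k ∉ Set.range (T.tri j) := by
  by_contra! h
  refine hij (T.eq_of_range_eq _ _ ?_)
  refine Set.eq_of_subset_of_ncard_le (Set.range_subset_iff.2 h) ?_ (Set.finite_range _)
  simp only [Set.ncard_range_of_injective (T.tri_injective _), le_refl]

lemma exists_some_tri_notMem_range (i : (T.centralSubdivision i₀).ι) :
    ∃ k, some (T.tri i₀ k) ∉ Set.range ((T.centralSubdivision i₀).tri i) := by
  rcases i with j | k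
  · obtain ⟨k, hk⟩ := exists_tri_notMem_range j.2.symm
    refine ⟨k, ?_⟩
    rintro ⟨l, hl⟩
    exact hk ⟨l, Option.some_injective _ hl⟩
  · exact ⟨k + 2, mt (some_apply_mem_range_coneTriangle_iff (T.tri_injective i₀)).1 (by simp)⟩

lemma sum_indicator_range_tri (c : ℝ) :
    ∑ v, (Set.range (T.tri i₀)).indicator (fun _ => c) v = 3 * c := by
  rw [← Fintype.sum_of_injective (T.tri i₀) (T.tri_injective i₀) (fun _ => c) _
    (fun v hv => Set.indicator_of_notMem hv _) fun k => by simp]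
  simp

variable (T i₀) in
/-- The smallest of the coordinates at the three vertices of the triangle `i₀`. -/
def minCoord (y : T.V → ℝ) : ℝ :=
  Finset.univ.inf' Finset.univ_nonempty (y ∘ T.tri i₀)

variable (T i₀) in
/-- The piecewise linear map of barycentric coordinates that sends the new vertex to the barycenter
of the triangle `i₀`. -/
def mergeCoords (x : Option T.V → ℝ) : T.V → ℝ :=
  fun v => x (some v) + (Set.range (T.tri i₀)).indicator (fun _ => x none / 3) v

variable (T i₀) in
/-- The inverse of `mergeCoords`: as much as possible of the weight on the triangle `i₀` is moved to
its barycenter. -/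
def splitCoords (y : T.V → ℝ) : Option T.V → ℝ
  | none => 3 * minCoord T i₀ y
  | some v => y v - (Set.range (T.tri i₀)).indicator (fun _ => minCoord T i₀ y) v

lemma minCoord_le (y : T.V → ℝ) (k : Fin 3) : minCoord T i₀ y ≤ y (T.tri i₀ k) :=
  Finset.inf'_le _ (Finset.mem_univ k)

lemma exists_minCoord_eq (y : T.V → ℝ) : ∃ k, minCoord T i₀ y = y (T.tri i₀ k) :=
  let ⟨k, _, hk⟩ := Finset.exists_mem_eq_inf' Finset.univ_nonempty (y ∘ T.tri i₀)
  ⟨k, hk⟩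

lemma minCoord_nonneg {y : T.V → ℝ} (hy : ∀ v, 0 ≤ y v) : 0 ≤ minCoord T i₀ y :=
  Finset.le_inf' _ _ fun _ _ => hy _

lemma continuous_minCoord : Continuous (minCoord T i₀) :=
  Continuous.finset_inf'_apply _ fun k _ => continuous_apply (T.tri i₀ k)

lemma mergeCoords_mem {x : Option T.V → ℝ}
    (hx : x ∈ realization (T.centralSubdivision i₀).complex) :
    mergeCoords T i₀ x ∈ realization T.complex := by
  obtain ⟨hnonneg, hsum, i, hi⟩ := mem_realization_complex_iff.1 hx
  refine mem_realization_complex_iff.2 ⟨fun v => ?_, ?_, parentTriangle i, fun v hv => ?_⟩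
  · exact add_nonneg (hnonneg _)
      (Set.indicator_nonneg (fun _ _ => div_nonneg (hnonneg _) (by norm_num)) _)
  · have hsum' : x none + ∑ v, x (some v) = 1 := (Fintype.sum_option x).symm.trans hsum
    simp only [mergeCoords, Finset.sum_add_distrib, sum_indicator_range_tri]
    linarith
  · by_cases hxv : x (some v) = 0
    · rw [mergeCoords, hxv, zero_add, Set.indicator_apply_ne_zero] at hv
      obtain ⟨hv, hnone⟩ := hv
      rwa [parentTriangle_eq_of_none_mem_range (hi none fun h => hnone (by simp [h]))]
    · exact mem_range_tri_parentTriangle (hi _ hxv)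

lemma exists_support_splitCoords_subset {y : T.V → ℝ} (hy : ∀ v, 0 ≤ y v) {j : T.ι}
    (hj : ∀ v, y v ≠ 0 → v ∈ Set.range (T.tri j)) :
    ∃ i, ∀ v, splitCoords T i₀ y v ≠ 0 →
      v ∈ Set.range ((T.centralSubdivision i₀).tri i) := by
  rcases eq_or_ne j i₀ with rfl | hne
  · obtain ⟨k, hk⟩ := exists_minCoord_eq (i₀ := j) y
    refine ⟨.inr (k + 1), ?_⟩
    rintro (_ | v) hv
    · exact none_mem_range_coneTriangle _
    · obtain ⟨l, rfl⟩ : v ∈ Set.range (T.tri j) := by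
        by_contra hv'
        rw [splitCoords, Set.indicator_of_notMem hv', sub_zero] at hv
        exact hv' (hj v hv)
      refine (some_apply_mem_range_coneTriangle_iff (T.tri_injective j)).2 ?_
      rintro rfl
      rw [add_assoc, show (1 + 2 : Fin 3) = 0 from rfl, add_zero] at hv
      simp [splitCoords, hk] at hv
  · obtain ⟨k, hk⟩ := exists_tri_notMem_range hne.symm
    have hmin : minCoord T i₀ y = 0 :=
      le_antisymm ((minCoord_le y k).trans_eq (not_imp_comm.1 (hj _) hk)) (minCoord_nonneg hy)
    refine ⟨.inl ⟨j, hne⟩, ?_⟩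
    rintro (_ | v) hv
    · simp [splitCoords, hmin] at hv
    · obtain ⟨l, rfl⟩ := hj v (by simpa [splitCoords, hmin] using hv)
      exact ⟨l, rfl⟩

lemma splitCoords_mem {y : T.V → ℝ} (hy : y ∈ realization T.complex) :
    splitCoords T i₀ y ∈ realization (T.centralSubdivision i₀).complex := by
  obtain ⟨hnonneg, hsum, j, hj⟩ := mem_realization_complex_iff.1 hy
  refine mem_realization_complex_iff.2 ⟨?_, ?_, exists_support_splitCoords_subset hnonneg hj⟩
  · rintro (_ | v)
    · exact mul_nonneg (by norm_num) (minCoord_nonneg hnonneg)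
    · refine sub_nonneg.2 (Set.indicator_le' ?_ (fun v _ => hnonneg v) v)
      rintro _ ⟨k, rfl⟩
      exact minCoord_le y k
  · refine (Fintype.sum_option (splitCoords T i₀ y)).trans ?_
    simp only [splitCoords, Finset.sum_sub_distrib, sum_indicator_range_tri]
    linarith

lemma mergeCoords_splitCoords (y : T.V → ℝ) : mergeCoords T i₀ (splitCoords T i₀ y) = y := by
  ext v
  simp [mergeCoords, splitCoords]

lemma minCoord_mergeCoords {x : Option T.V → ℝ}
    (hx : x ∈ realization (T.centralSubdivision i₀).complex) :
    minCoord T i₀ (mergeCoords T i₀ x) = x none / 3 := by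
  obtain ⟨hnonneg, -, i, hi⟩ := mem_realization_complex_iff.1 hx
  have hmerge (k : Fin 3) :
      mergeCoords T i₀ x (T.tri i₀ k) = x (some (T.tri i₀ k)) + x none / 3 := by
    simp [mergeCoords]
  obtain ⟨k, hk⟩ := exists_some_tri_notMem_range i
  refine le_antisymm ((minCoord_le _ k).trans_eq ?_) (Finset.le_inf' _ _ fun l _ => ?_)
  · rw [hmerge, not_imp_comm.1 (hi _) hk, zero_add]
  · exact (le_add_of_nonneg_left (hnonneg _)).trans_eq (hmerge l).symm

lemma splitCoords_mergeCoords {x : Option T.V → ℝ}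
    (hx : x ∈ realization (T.centralSubdivision i₀).complex) :
    splitCoords T i₀ (mergeCoords T i₀ x) = x := by
  ext (_ | v) <;> simp only [splitCoords, minCoord_mergeCoords hx]
  · exact mul_div_cancel₀ _ three_ne_zero
  · exact add_sub_cancel_right _ _

lemma continuous_indicator_const {α X M : Type*} [TopologicalSpace X] [TopologicalSpace M] [Zero M]
    (s : Set α) {f : X → M} (hf : Continuous f) (a : α) :
    Continuous fun x => s.indicator (fun _ => f x) a := by
  by_cases ha : a ∈ s
  · simpa [ha] using hf
  · simpa [ha] using continuous_const

lemma continuous_mergeCoords : Continuous (mergeCoords T i₀) :=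
  continuous_pi fun v => (continuous_apply _).add
    (continuous_indicator_const _ ((continuous_apply none).div_const 3) v)

lemma continuous_splitCoords : Continuous (splitCoords T i₀) :=
  continuous_pi fun
    | none => continuous_const.mul continuous_minCoord
    | some v => (continuous_apply v).sub (continuous_indicator_const _ continuous_minCoord v)

variable (T i₀) in
/-- The homeomorphism between the realizations of a central subdivision and of the complex itself
that sends the new vertex to the barycenter of the triangle `i₀`. -/
def centralSubdivisionHomeomorph :
    realization (T.centralSubdivision i₀).complex ≃ₜ realization T.complex where
  toFun x := ⟨mergeCoords T i₀ x.1, mergeCoords_mem x.2⟩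
  invFun y := ⟨splitCoords T i₀ y.1, splitCoords_mem y.2⟩
  left_inv x := Subtype.ext (splitCoords_mergeCoords x.2)
  right_inv _ := Subtype.ext (mergeCoords_splitCoords _)
  continuous_toFun := (continuous_mergeCoords.comp continuous_subtype_val).subtype_mk _
  continuous_invFun := (continuous_splitCoords.comp continuous_subtype_val).subtype_mk _

end OrientedTriangles

open OrientedTriangles in
/-- The triangulation obtained from `T` by central subdivision of the triangle `i₀`. -/
abbrev Triangulation.subdivide (T : Triangulation) (i₀ : T.ι) : Triangulation where
  toOrientedTriangles := T.toOrientedTriangles.centralSubdivision i₀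
  homeomorphic_disk :=
    T.homeomorphic_disk.map ((centralSubdivisionHomeomorph T.toOrientedTriangles i₀).trans ·)
  coherent := centralSubdivision_coherent T.coherent
  corner k := some (T.corner k)
  corner_injective := (Option.some_injective _).comp T.corner_injective
  boundary_iff := by
    rintro (_ | u) (_ | v)
    · simp
    · simp [exists_hasDirectedEdge_none_left_iff_none_right]
    · simp [exists_hasDirectedEdge_none_left_iff_none_right]
    · rw [exists_hasDirectedEdge_some_some_iff, exists_hasDirectedEdge_some_some_iff,
        T.boundary_iff]
      exact exists_congr fun _ => and_congr Option.some_inj.symm Option.some_inj.symm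

/-! ### Areas of a central subdivision -/

section Areas

lemma area_eq (a b c : Fin 2 → ℂ) :
    area a b c = 1 / 2 * ((b 0 - a 0) * (c 1 - a 1) - (c 0 - a 0) * (b 1 - a 1)) := by
  simp only [area, Matrix.det_fin_three, Matrix.of_apply, Matrix.cons_val]
  ring

lemma sum_area_eq (t : Fin 3 → Fin 2 → ℂ) (d : Fin 2 → ℂ) :
    ∑ k, area (t k) (t (k + 1)) d = area (t 0) (t 1) (t 2) := by
  simp only [Fin.sum_univ_three, area_eq, zero_add, Fin.reduceAdd]
  ring

lemma area_rotate (t : Fin 3 → Fin 2 → ℂ) (k : Fin 3) :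
    area (t k) (t (k + 1)) (t (k + 2)) = area (t 0) (t 1) (t 2) := by
  fin_cases k <;> simp [area_eq] <;> ring

lemma area_affineCombination (a b c : Fin 2 → ℂ) {α β γ : ℂ} (h : α + β + γ = 1) :
    area a b (α • a + β • b + γ • c) = γ * area a b c := by
  obtain rfl : α = 1 - β - γ := by linear_combination h
  simp only [area_eq, Pi.add_apply, Pi.smul_apply, smul_eq_mul]
  ring

lemma exists_area_eq {t : Fin 3 → Fin 2 → ℂ} (ht : area (t 0) (t 1) (t 2) ≠ 0) {x : Fin 3 → ℂ}
    (hx : ∑ k, x k = area (t 0) (t 1) (t 2)) : ∃ d, ∀ k, area (t k) (t (k + 1)) d = x k := by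
  set S := area (t 0) (t 1) (t 2) with hS
  -- The barycentric coordinates of `d` are proportional to the areas that it cuts off.
  refine ⟨∑ k, (x (k + 1) / S) • t k, fun k => ?_⟩
  have hrotate {M : Type} [AddCommMonoid M] (f : Fin 3 → M) :
      ∑ l, f l = f k + f (k + 1) + f (k + 2) := by
    rw [← Equiv.sum_comp (Equiv.addLeft k), Fin.sum_univ_three]
    simp
  have hshift : ∑ l, x (l + 1) = S := (Equiv.sum_comp (Equiv.addRight 1) x).trans hx
  have hweights : ∑ l, x (l + 1) / S = 1 := by rw [← Finset.sum_div, hshift, div_self ht]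
  rw [hrotate] at hweights ⊢
  rw [area_affineCombination _ _ _ hweights, area_rotate, ← hS, div_mul_cancel₀ _ ht, add_assoc]
  simp

variable {T : Triangulation}

lemma mem_drawings_iff {ρ : T.V → Fin 2 → ℂ} (k : Fin 4) :
    ρ ∈ drawings T ↔
      ρ (T.corner k) + ρ (T.corner (k + 2)) = ρ (T.corner (k + 1)) + ρ (T.corner (k + 3)) := by
  change _ = _ ↔ _
  fin_cases k <;>
    simp only [Fin.reduceFinMk, Fin.isValue, Fin.reduceAdd, zero_add, add_comm, eq_comm]

lemma lineMap_mem_drawings {ρ ρ' : T.V → Fin 2 → ℂ} (hρ : ρ ∈ drawings T) (hρ' : ρ' ∈ drawings T)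
    (t : ℂ) : AffineMap.lineMap ρ ρ' t ∈ drawings T := by
  ext l
  have h := congrFun hρ l
  have h' := congrFun hρ' l
  simp only [AffineMap.lineMap_apply_module, Pi.add_apply, Pi.smul_apply, smul_eq_mul] at h h' ⊢
  linear_combination (1 - t) * h + t * h'

lemma exists_corner_notMem_range (i : T.ι) : ∃ k, T.corner k ∉ Set.range (T.tri i) := by
  by_contra! h
  have hcard := Set.ncard_le_ncard (Set.range_subset_iff.2 h)
  simp [Set.ncard_range_of_injective, T.corner_injective, T.tri_injective i] at hcard

lemma exists_areaTuple_ne_zero (i : T.ι) : ∃ ρ ∈ drawings T, areaTuple T ρ i ≠ 0 := by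
  classical
  obtain ⟨k, hk⟩ := exists_corner_notMem_range i
  let σ : T.V → Fin 2 → ℂ := Function.extend (T.tri i) ![0, ![1, 0], ![0, 1]] 0
  let w := σ (T.corner (k + 1)) + σ (T.corner (k + 3)) - σ (T.corner (k + 2))
  refine ⟨Function.update σ (T.corner k) w, (mem_drawings_iff k).2 ?_, ?_⟩
  · simp [T.corner_injective.eq_iff, w]
  · have hσ (l : Fin 3) : Function.update σ (T.corner k) w (T.tri i l) =
        ![0, ![1, 0], ![0, 1]] l := by
      rw [Function.update_of_ne fun h => hk ⟨l, h⟩]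
      exact (T.tri_injective i).extend_apply _ _ _
    simp [areaTuple, hσ, area_eq]

lemma exists_polynomial_areaTuple_lineMap (ρ ρ' : T.V → Fin 2 → ℂ) :
    ∃ P : T.ι → Polynomial ℂ, ∀ t,
      (fun i => (P i).eval t) = areaTuple T (AffineMap.lineMap ρ ρ' t) := by
  let x (v : T.V) (l : Fin 2) : Polynomial ℂ :=
    (1 - Polynomial.X) * Polynomial.C (ρ v l) + Polynomial.X * Polynomial.C (ρ' v l)
  refine ⟨fun i => Polynomial.C (1 / 2) *
    ((x (T.tri i 1) 0 - x (T.tri i 0) 0) * (x (T.tri i 2) 1 - x (T.tri i 0) 1) -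
      (x (T.tri i 2) 0 - x (T.tri i 0) 0) * (x (T.tri i 1) 1 - x (T.tri i 0) 1)), fun t => ?_⟩
  ext i
  simp [areaTuple, area_eq, x, AffineMap.lineMap_apply_module, mul_comm t]

lemma isPrime_vanishingIdeal_areaTuple (T : Triangulation) :
    (vanishingIdeal ℂ (areaTuple T '' drawings T)).IsPrime := by
  have hzero : (0 : T.V → Fin 2 → ℂ) ∈ drawings T := by simp [drawings]
  refine isPrime_vanishingIdeal_of_curves ⟨_, 0, hzero, rfl⟩ ?_
  rintro _ ⟨ρ, hρ, rfl⟩ _ ⟨ρ', hρ', rfl⟩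
  obtain ⟨P, hP⟩ := exists_polynomial_areaTuple_lineMap ρ ρ'
  refine ⟨P, fun t => hP t ▸ ⟨_, lineMap_mem_drawings hρ hρ' t, rfl⟩, fun i => ?_, fun i => ?_⟩
  · simpa using congrFun (hP 0) i
  · simpa using congrFun (hP 1) i

open OrientedTriangles

variable {i₀ : T.ι}

lemma fiberSum_areaTuple_subdivide (ρ : (T.subdivide i₀).V → Fin 2 → ℂ) :
    fiberSum (parentTriangle (i₀ := i₀)) (areaTuple (T.subdivide i₀) ρ) =
      areaTuple T (ρ ∘ some) := by
  ext j
  rcases eq_or_ne j i₀ with rfl | hj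
  · exact (fiberSum_parentTriangle_self _).trans (sum_area_eq (ρ ∘ some ∘ T.tri j) (ρ none))
  · exact fiberSum_parentTriangle_of_ne _ ⟨j, hj⟩

lemma mem_areaTuple_subdivide_of_fiberSum_eq {ρ : T.V → Fin 2 → ℂ} (hρ : ρ ∈ drawings T)
    (hne : areaTuple T ρ i₀ ≠ 0) {x : (T.subdivide i₀).ι → ℂ}
    (hx : fiberSum (parentTriangle (i₀ := i₀)) x = areaTuple T ρ) :
    x ∈ areaTuple (T.subdivide i₀) '' drawings (T.subdivide i₀) := by
  have hsum := (fiberSum_parentTriangle_self x).symm.trans (congrFun hx i₀)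
  obtain ⟨d, hd⟩ := exists_area_eq (t := ρ ∘ T.tri i₀) hne hsum
  refine ⟨fun v => v.elim d ρ, hρ, ?_⟩
  ext (j | k)
  · exact (congrFun hx j).symm.trans (fiberSum_parentTriangle_of_ne x j)
  · exact hd k

lemma vanishingIdeal_areaTuple_subdivide (i₀ : T.ι) :
    vanishingIdeal ℂ (areaTuple (T.subdivide i₀) '' drawings (T.subdivide i₀)) =
      (vanishingIdeal ℂ (areaTuple T '' drawings T)).map
        (fiberSubst (parentTriangle (i₀ := i₀))) := by
  set S := areaTuple T '' drawings T
  have hX : X i₀ ∉ vanishingIdeal ℂ S := fun h => by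
    obtain ⟨ρ, hρ, hne⟩ := exists_areaTuple_ne_zero i₀
    exact hne (by simpa using h _ ⟨ρ, hρ, rfl⟩)
  refine le_antisymm ?_ ?_
  · rw [← vanishingIdeal_inter_setOf_ne_zero (isPrime_vanishingIdeal_areaTuple T) hX,
      ← vanishingIdeal_preimage_fiberSum parentTriangle_surjective]
    refine vanishingIdeal_anti_mono ?_
    rintro x ⟨⟨ρ, hρ, hx⟩, hne⟩
    refine mem_areaTuple_subdivide_of_fiberSum_eq hρ ?_ hx.symm
    simpa [hx] using hne
  · rw [← vanishingIdeal_preimage_fiberSum parentTriangle_surjective]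
    refine vanishingIdeal_anti_mono ?_
    rintro _ ⟨ρ, hρ, rfl⟩
    exact ⟨ρ ∘ some, hρ, (fiberSum_areaTuple_subdivide ρ).symm⟩

theorem IsAreaPolynomial.subdivide {p : MvPolynomial T.ι ℤ} (hp : IsAreaPolynomial T p)
    (i₀ : T.ι) :
    IsAreaPolynomial (T.subdivide i₀) (fiberSubst (parentTriangle (i₀ := i₀)) p) := by
  obtain ⟨⟨d, hd⟩, hprim, hideal⟩ := hp
  refine ⟨⟨d, isHomogeneous_fiberSubst hd _⟩,
    fun c hc => hprim c (C_dvd_of_C_dvd_fiberSubst parentTriangle_surjective hc), ?_⟩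
  rw [vanishingIdeal_areaTuple_subdivide, hideal, Ideal.map_span, Set.image_singleton,
    map_fiberSubst]

end Areas

/-! ### Specializations and algebraic subdivisions -/

section Encyclopedia

variable {K : Type*} [Field K]

lemma rename_specialize {σ τ R : Type*} [Fintype τ] [CommRing R] (L : Finset σ) (e : L ≃ τ)
    (p : MvPolynomial σ R) :
    rename e (specialize L p) = fiberSubst (fun t => (e.symm t : σ)) p := by
  have hinj : Function.Injective fun t => (e.symm t : σ) :=
    Subtype.val_injective.comp e.symm.injective
  rw [specialize, ← AlgHom.comp_apply, comp_aeval, fiberSubst]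
  congr 2
  ext1 i
  by_cases hi : i ∈ L
  · have hfiber := fiberSum_apply_of_injective hinj (X : τ → MvPolynomial τ R) (e ⟨i, hi⟩)
    rw [Equiv.symm_apply_apply] at hfiber
    rw [dif_pos hi, rename_X, hfiber]
  · rw [dif_neg hi, map_zero, fiberSum_apply_of_notMem_range]
    rintro ⟨t, rfl⟩
    exact hi (e.symm t).2

lemma isAreaFactor_iff {l : ℕ} {q : MvPolynomial (Fin l) K} :
    IsAreaFactor q ↔ Irreducible q ∧ ∃ (T : Triangulation) (p : MvPolynomial T.ι ℤ)
      (f : Fin l → T.ι), Function.Injective f ∧ IsAreaPolynomial T p ∧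
        q ∣ fiberSubst f (map (Int.castRingHom K) p) := by
  constructor
  · rintro ⟨T, p, L, e, hp, hq, hdvd⟩
    rw [rename_specialize] at hdvd
    exact ⟨hq, T, p, _, Subtype.val_injective.comp e.symm.injective, hp, hdvd⟩
  · rintro ⟨hq, T, p, f, hf, hp, hdvd⟩
    let e : Fin l ≃ (Finset.univ.map ⟨f, hf⟩ : Finset T.ι) :=
      (Equiv.ofInjective f hf).trans (Equiv.subtypeEquivRight fun i => by simp)
    refine ⟨T, p, _, e.symm, hp, hq, ?_⟩
    rw [rename_specialize]
    exact hdvd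

lemma IsAreaFactor.of_polyEquiv {l : ℕ} {q q' : MvPolynomial (Fin l) K} (hq : IsAreaFactor q)
    (h : PolyEquiv q q') : IsAreaFactor q' := by
  obtain ⟨T, p, L, e, hp, hirr, hdvd⟩ := hq
  obtain ⟨c, hc, π, rfl⟩ := h
  have hassoc : Associated (rename π q) (C c * rename π q) :=
    ⟨(hc.isUnit.map (C : K →+* MvPolynomial (Fin l) K)).unit, by simp [mul_comm]⟩
  refine ⟨T, p, L, e.trans π, hp, hassoc.irreducible ?_, hassoc.dvd_iff_dvd_left.1 ?_⟩
  · exact (MulEquiv.irreducible_iff (renameEquiv K π)).2 hirr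
  · have hdvd' := map_dvd (rename π) hdvd
    rwa [rename_rename] at hdvd'

lemma mem_encyclopedia_iff {l : ℕ} {q : MvPolynomial (Fin l) K} :
    q ∈ encyclopedia K l ↔ 0 < l ∧ IsAreaFactor q :=
  and_congr_right fun _ => ⟨fun ⟨_, h, hq'⟩ => hq'.of_polyEquiv h,
    fun h => ⟨q, ⟨1, one_ne_zero, 1, by simp⟩, h⟩⟩

/-- The map that merges the two variables introduced by an algebraic subdivision: it sends
`e (some j)` to `j` and `e none` to `i`. -/
def mergeAt {n : ℕ} (i : Fin n) (e : Option (Fin n) ≃ Fin (n + 1)) (a : Fin (n + 1)) : Fin n :=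
  (e.symm a).getD i

lemma mergeAt_surjective {n : ℕ} (i : Fin n) (e : Option (Fin n) ≃ Fin (n + 1)) :
    Function.Surjective (mergeAt i e) :=
  fun j => ⟨e (some j), by simp [mergeAt]⟩

lemma isAlgSubdivision_iff {n : ℕ} {q : MvPolynomial (Fin n) K}
    {q' : MvPolynomial (Fin (n + 1)) K} :
    IsAlgSubdivision q q' ↔ ∃ i e, q' = fiberSubst (mergeAt i e) q := by
  classical
  refine exists_congr fun i => exists_congr fun e => ?_
  suffices hsum : (fun j => if j = i then X (e (some i)) + X (e none) else X (e (some j))) =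
      fiberSum (mergeAt i e) (X : _ → MvPolynomial (Fin (n + 1)) K) by rw [hsum, fiberSubst]
  ext1 j
  rw [fiberSum, Finset.sum_filter, ← Equiv.sum_comp e, Fintype.sum_option]
  by_cases hj : j = i <;> simp [mergeAt, hj, Ne.symm, add_comm]

lemma IsAreaFactor.of_fiberSubst {m n : ℕ} {s : Fin m → Fin n} (hs : Function.Surjective s)
    {q : MvPolynomial (Fin n) K} (hq : IsAreaFactor (fiberSubst s q)) : IsAreaFactor q := by
  obtain ⟨hirr, T, p, f, hf, hp, hdvd⟩ := isAreaFactor_iff.1 hq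
  have hr := Function.rightInverse_surjInv hs
  refine isAreaFactor_iff.2 ⟨(irreducible_fiberSubst_iff hs).1 hirr, T, p,
    f ∘ Function.surjInv hs, hf.comp hr.injective, hp, ?_⟩
  simpa only [fiberSubst_fiberSubst_of_rightInverse hr, fiberSubst_fiberSubst]
    using map_dvd (fiberSubst (Function.surjInv hs)) hdvd

lemma exists_injective_parentTriangle_comp_eq {T : Triangulation} {σ : Type*} {f : σ → T.ι}
    (hf : Function.Injective f) (i : σ) :
    ∃ g : Option σ → (T.subdivide (f i)).ι, Function.Injective g ∧
      ∀ o, OrientedTriangles.parentTriangle (g o) = f (o.getD i) := by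
  have hr := Function.rightInverse_surjInv (OrientedTriangles.parentTriangle_surjective (i₀ := f i))
  set r := Function.surjInv (OrientedTriangles.parentTriangle_surjective (i₀ := f i))
  obtain ⟨k, hk⟩ : ∃ k, r (f i) ≠ .inr k := by
    by_contra! hall
    cases (hall 0).symm.trans (hall 1)
  refine ⟨fun o => o.elim (.inr k) (r ∘ f), Option.injective_iff.2 ⟨hr.injective.comp hf, ?_⟩, ?_⟩
  · rintro ⟨j, hj⟩
    obtain rfl : j = i := hf ((hr (f j)).symm.trans (congrArg _ hj))
    exact hk hj
  · rintro (_ | j)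
    exacts [rfl, hr (f j)]

lemma IsAreaFactor.fiberSubst_mergeAt {n : ℕ} {q : MvPolynomial (Fin n) K}
    (hq : IsAreaFactor q) (i : Fin n) (e : Option (Fin n) ≃ Fin (n + 1)) :
    IsAreaFactor (fiberSubst (mergeAt i e) q) := by
  obtain ⟨hirr, T, p, f, hf, hp, hdvd⟩ := isAreaFactor_iff.1 hq
  obtain ⟨g, hg, hgf⟩ := exists_injective_parentTriangle_comp_eq hf i
  refine isAreaFactor_iff.2 ⟨(irreducible_fiberSubst_iff (mergeAt_surjective i e)).2 hirr,
    T.subdivide (f i), _, g ∘ e.symm, hg.comp e.symm.injective, hp.subdivide (f i), ?_⟩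
  have hcomp : OrientedTriangles.parentTriangle ∘ g ∘ e.symm = f ∘ mergeAt i e :=
    funext fun a => hgf (e.symm a)
  rw [map_fiberSubst, fiberSubst_fiberSubst, hcomp, ← fiberSubst_fiberSubst]
  exact map_dvd _ hdvd

lemma mem_encyclopedia_iff_of_isAlgSubdivision {l : ℕ} {q : MvPolynomial (Fin l) K}
    {q' : MvPolynomial (Fin (l + 1)) K} (h : IsAlgSubdivision q q') :
    q' ∈ encyclopedia K (l + 1) ↔ q ∈ encyclopedia K l := by
  obtain ⟨i, e, rfl⟩ := isAlgSubdivision_iff.1 h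
  rw [mem_encyclopedia_iff, mem_encyclopedia_iff]
  exact ⟨fun h => ⟨i.pos, h.2.of_fiberSubst (mergeAt_surjective i e)⟩,
    fun h => ⟨l.succ_pos, h.2.fiberSubst_mergeAt i e⟩⟩

lemma IsAlgSubdivision.exists_of_polyEquiv {l : ℕ} {r : MvPolynomial (Fin l) K}
    {q q' : MvPolynomial (Fin (l + 1)) K} (h : IsAlgSubdivision r q') (hq : PolyEquiv q' q) :
    ∃ r', IsAlgSubdivision r' q := by
  obtain ⟨i, e, rfl⟩ := isAlgSubdivision_iff.1 h
  obtain ⟨c, -, π, rfl⟩ := hq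
  refine ⟨C c * r, isAlgSubdivision_iff.2 ⟨i, e.trans π, ?_⟩⟩
  rw [map_mul, algHom_C, algebraMap_eq, ← Equiv.symm_symm π, ← fiberSubst_equiv,
    fiberSubst_fiberSubst]
  rfl

lemma SubdivisionStep.isAlgSubdivision {l : ℕ} {r : MvPolynomial (Fin l) K}
    {q : MvPolynomial (Fin (l + 1)) K} (h : SubdivisionStep ⟨l, r⟩ ⟨l + 1, q⟩) :
    IsAlgSubdivision r q := by
  cases h
  assumption

lemma exists_abridged_reflTransGen (l : ℕ) (q : MvPolynomial (Fin l) K)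
    (hq : q ∈ encyclopedia K l) :
    ∃ (m : ℕ) (q₀ : MvPolynomial (Fin m) K), q₀ ∈ abridged K m ∧
      Relation.ReflTransGen SubdivisionStep ⟨m, q₀⟩ ⟨l, q⟩ := by
  induction l with
  | zero => exact absurd hq.1 (lt_irrefl 0)
  | succ l ih =>
    by_cases habridged : q ∈ abridged K (l + 1)
    · exact ⟨_, q, habridged, .refl⟩
    · obtain ⟨r, -, q', hequiv, hstep⟩ := not_not.1 fun h => habridged ⟨hq, h⟩
      obtain ⟨r', hsub⟩ := hstep.isAlgSubdivision.exists_of_polyEquiv hequiv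
      obtain ⟨m, q₀, hq₀, hgen⟩ := ih r' ((mem_encyclopedia_iff_of_isAlgSubdivision hsub).1 hq)
      exact ⟨m, q₀, hq₀, hgen.tail ⟨r', q, hsub⟩⟩

lemma mem_encyclopedia_of_reflTransGen {a b : Σ n : ℕ, MvPolynomial (Fin n) K}
    (h : Relation.ReflTransGen SubdivisionStep a b) (ha : a.2 ∈ encyclopedia K a.1) :
    b.2 ∈ encyclopedia K b.1 := by
  induction h with
  | refl => exact ha
  | tail _ hstep ih =>
    obtain ⟨q, q', h⟩ := hstep
    exact (mem_encyclopedia_iff_of_isAlgSubdivision h).2 ih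

end Encyclopedia

end AreaEncyclopedia

end

theorem mainTheorem10_general (K : Type*) [Field K] :
    (∀ (l : ℕ) (q : MvPolynomial (Fin l) K) (q' : MvPolynomial (Fin (l + 1)) K),
      AreaEncyclopedia.IsAlgSubdivision q q' →
        (q' ∈ AreaEncyclopedia.encyclopedia K (l + 1) ↔ q ∈ AreaEncyclopedia.encyclopedia K l)) ∧
    (∀ (l : ℕ) (q : MvPolynomial (Fin l) K),
      q ∈ AreaEncyclopedia.encyclopedia K l ↔
        ∃ (m : ℕ) (q₀ : MvPolynomial (Fin m) K), q₀ ∈ AreaEncyclopedia.abridged K m ∧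
          Relation.ReflTransGen AreaEncyclopedia.SubdivisionStep ⟨m, q₀⟩ ⟨l, q⟩) :=
  ⟨fun _ _ _ => AreaEncyclopedia.mem_encyclopedia_iff_of_isAlgSubdivision,
    fun l q => ⟨AreaEncyclopedia.exists_abridged_reflTransGen l q,
      fun ⟨_, _, hq₀, hsteps⟩ => AreaEncyclopedia.mem_encyclopedia_of_reflTransGen hsteps hq₀.1⟩⟩

theorem mainTheorem10 (K : Type*) [Field K] [CharZero K] :
    (∀ (l : ℕ) (q : MvPolynomial (Fin l) K) (q' : MvPolynomial (Fin (l + 1)) K),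
      AreaEncyclopedia.IsAlgSubdivision q q' →
        (q' ∈ AreaEncyclopedia.encyclopedia K (l + 1) ↔ q ∈ AreaEncyclopedia.encyclopedia K l)) ∧
    (∀ (l : ℕ) (q : MvPolynomial (Fin l) K),
      q ∈ AreaEncyclopedia.encyclopedia K l ↔
        ∃ (m : ℕ) (q₀ : MvPolynomial (Fin m) K), q₀ ∈ AreaEncyclopedia.abridged K m ∧
          Relation.ReflTransGen AreaEncyclopedia.SubdivisionStep ⟨m, q₀⟩ ⟨l, q⟩) :=
  mainTheorem10_general K
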